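/- Let $d\ge 1$, and let $|\cdot|$ denote the $\ell^\infty$-norm on $\mathbb{Z}^d$. For $\phi\in\ell^2(\mathbb{Z}^d)$ let $$\mathcal{LC}(\phi)=\Big\{l\in\mathbb{Z}^d:\ |\phi(l)|=\max_{x\in\mathbb{Z}^d}|\phi(x)|\Big\}$$ be its set of localization centers. Let $C,c,q>0$ and $\epsilon>0$. Then there is a scale $L''_\epsilon\ge 500$, depending only on $\epsilon,C,c,q,d$, with the following property. Let $H$ be a (possibly unbounded) linear operator on $\ell^2(\mathbb{Z}^d)$ that has an orthonormal basis $\{\psi_s\}_{s\in\mathbb{Z}^d}$ of $\ell^2(\mathbb{Z}^d)$ consisting of eigenfunctions, and suppose that these are semi-uniformly localized: $$|\psi_s(x)|\le C(1+|l|)^q e^{-c|x-l|}\qquad\text{for all } s\in\mathbb{Z}^d,\ l\in\mathcal{LC}(\psi_s),\ x\in\mathbb{Z}^d .$$ Then there is a bijection $f:\mathbb{Z}^d\to\mathbb{Z}^d$ such that the relabelled eigenfunctions $\phi_j:=\psi_{f(j)}$ satisfy: for every $j\in\mathbb{Z}^d$ with $|j|\ge L''_\epsilon$ there is $\iota_j\in\mathcal{LC}(\phi_j)$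 with $|j-\iota_j|\le\epsilon|j|$. -/

import Mathlib

/-- The lattice `ℤ^d`; its norm `‖·‖` is the sup norm. -/
abbrev ZLattice (d : ℕ) : Type := Fin d → ℤ

/-- The Hilbert space `ℓ²(ℤ^d)` of square-summable complex functions on the lattice. -/
abbrev EllTwo (d : ℕ) : Type := lp (fun _ : ZLattice d => ℂ) 2

/-- `φ` is an eigenfunction of the (possibly unbounded, only partially defined)
linear operator `H` on `ℓ²(ℤ^d)`. -/
def IsEigenfunction {d : ℕ} (H : EllTwo d →ₗ.[ℂ] EllTwo d) (φ : EllTwo d) : Prop :=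
  φ ≠ 0 ∧ ∃ (μ : ℂ) (hφ : φ ∈ H.domain), H ⟨φ, hφ⟩ = μ • φ

/-- The set of localization centers of `φ`: the sites where `|φ|` attains its maximum. -/
def localizationCenters {d : ℕ} (φ : EllTwo d) : Set (ZLattice d) :=
  {l | ∀ x : ZLattice d, ‖φ x‖ ≤ ‖φ l‖}

/-- Semi-uniform localization control of `φ` with constants `C`, `c`, `q`. -/
def SemiUniformlyLocalized {d : ℕ} (C c q : ℝ) (φ : EllTwo d) : Prop :=
  ∀ l ∈ localizationCenters φ, ∀ x : ZLattice d,
    ‖φ x‖ ≤ C * (1 + ‖l‖) ^ q * Real.exp (-c * ‖x - l‖)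

/-!
For an orthonormal basis `ψ` of `ℓ²(ℤ^d)` the matrix `|ψ_s(x)|²` is doubly stochastic. The mass of
a normalized localized function `φ` outside the ball of radius `r` around a localization center
`l` is at most `K (1 + |l|)^{4q} e^{-cr} |φ(l)|²`. Relating `x` to `s` when
`|x - l_s| ≤ δ (|l_s| + L)`, the masses that the `ψ_s` have outside the relation amount together
to at most `∑_y K (1 + |y|)^{4q} e^{-cδ(|y| + L)}`, which is below one once `L` is large. An
infinite matrix with unit row and column sums and less than one unit of mass off a locally finite
relation satisfies Hall's condition in both directions, and the two resulting injections combine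
to a bijection by the Schröder–Bernstein theorem.
-/

open Filter Asymptotics Topology
open scoped ENNReal

/-! ### Matchings from doubly stochastic weights -/

section Matching

variable {α β : Type*} {a : α → β → ℝ≥0∞} {R : α → β → Prop}

/-- The total weight that the matrix `a` puts outside the relation `R`. For a doubly stochastic
matrix, a defect below one forces Hall's condition for `R`. -/
noncomputable def matchingDefect (a : α → β → ℝ≥0∞) (R : α → β → Prop) : ℝ≥0∞ :=
  ∑' x, ∑' s, {s | ¬ R x s}.indicator (a x) s

theorem matchingDefect_flip (a : α → β → ℝ≥0∞) (R : α → β → Prop) :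
    matchingDefect (flip a) (flip R) = matchingDefect a R :=
  ENNReal.tsum_comm

theorem card_le_card_of_matchingDefect_lt_one (hrow : ∀ x, 1 ≤ ∑' s, a x s)
    (hcol : ∀ s, ∑' x, a x s ≤ 1) (hdefect : matchingDefect a R < 1) {A : Finset α} {B : Finset β}
    (hAB : ∀ x ∈ A, ∀ s, R x s → s ∈ B) : A.card ≤ B.card := by
  have row_split : ∀ x ∈ A,
      1 ≤ ∑ s ∈ B, a x s + ∑' s, {s | ¬ R x s}.indicator (a x) s := fun x hx => by
    refine (hrow x).trans ?_
    rw [sum_eq_tsum_indicator, ← ENNReal.tsum_add]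
    refine ENNReal.tsum_le_tsum fun s => ?_
    by_cases h : R x s
    · simp [hAB x hx s h]
    · simp [h]
  have card_le : (A.card : ℝ≥0∞) ≤ B.card + matchingDefect a R := by
    calc (A.card : ℝ≥0∞) = ∑ x ∈ A, 1 := by simp
      _ ≤ ∑ x ∈ A, (∑ s ∈ B, a x s + ∑' s, {s | ¬ R x s}.indicator (a x) s) :=
        Finset.sum_le_sum row_split
      _ = ∑ s ∈ B, ∑ x ∈ A, a x s + ∑ x ∈ A, ∑' s, {s | ¬ R x s}.indicator (a x) s := by
        rw [Finset.sum_add_distrib, Finset.sum_comm]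
      _ ≤ ∑ s ∈ B, 1 + matchingDefect a R := by
        gcongr with s
        · exact (ENNReal.sum_le_tsum A).trans (hcol s)
        · exact ENNReal.sum_le_tsum A
      _ = B.card + matchingDefect a R := by simp
  have card_lt : (A.card : ℝ≥0∞) < B.card + 1 :=
    card_le.trans_lt (ENNReal.add_lt_add_left (ENNReal.natCast_ne_top _) hdefect)
  exact Nat.lt_succ_iff.mp (by exact_mod_cast card_lt)

theorem exists_injective_of_matchingDefect_lt_one (hrow : ∀ x, 1 ≤ ∑' s, a x s)
    (hcol : ∀ s, ∑' x, a x s ≤ 1) (hdefect : matchingDefect a R < 1)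
    (hfin : ∀ x, {s | R x s}.Finite) :
    ∃ f : α → β, f.Injective ∧ ∀ x, R x (f x) := by
  classical
  obtain ⟨f, hf, hfR⟩ :=
    (Finset.all_card_le_biUnion_card_iff_exists_injective fun x => (hfin x).toFinset).mp
      fun A => card_le_card_of_matchingDefect_lt_one hrow hcol hdefect fun x hx s hs =>
        Finset.mem_biUnion.mpr ⟨x, hx, (hfin x).mem_toFinset.mpr hs⟩
  exact ⟨f, hf, fun x => (hfin x).mem_toFinset.mp (hfR x)⟩

theorem exists_equiv_of_matchingDefect_lt_one (hrow : ∀ x, ∑' s, a x s = 1)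
    (hcol : ∀ s, ∑' x, a x s = 1) (hdefect : matchingDefect a R < 1)
    (hfin : ∀ x, {s | R x s}.Finite) (hfin' : ∀ s, {x | R x s}.Finite) :
    ∃ f : α ≃ β, ∀ x, R x (f x) := by
  obtain ⟨f, hf, hfR⟩ := exists_injective_of_matchingDefect_lt_one
    (fun x => (hrow x).ge) (fun s => (hcol s).le) hdefect hfin
  obtain ⟨g, hg, hgR⟩ := exists_injective_of_matchingDefect_lt_one (a := flip a) (R := flip R)
    (fun s => (hcol s).ge) (fun x => (hrow x).le) ((matchingDefect_flip a R).trans_lt hdefect) hfin'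
  obtain ⟨h, hh, hhR⟩ := Function.Embedding.schroeder_bernstein_of_rel hf hg R hfR hgR
  exact ⟨Equiv.ofBijective h hh, hhR⟩

theorem tsum_mul_comp_le_tsum (hrow : ∀ x, ∑' s, a x s ≤ 1) (l : β → α) (w : α → ℝ≥0∞) :
    ∑' s, a (l s) s * w (l s) ≤ ∑' x, w x :=
  calc ∑' s, a (l s) s * w (l s)
    _ ≤ ∑' s, ∑' x, a x s * w x := ENNReal.tsum_le_tsum fun s => ENNReal.le_tsum (l s)
    _ = ∑' x, (∑' s, a x s) * w x := by simp_rw [ENNReal.tsum_comm (α := β), ENNReal.tsum_mul_right]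
    _ ≤ ∑' x, w x := ENNReal.tsum_le_tsum fun x => mul_le_of_le_one_left' (hrow x)

theorem matchingDefect_le_tsum (hrow : ∀ x, ∑' s, a x s ≤ 1) (l : β → α) (w : α → ℝ≥0∞)
    (htail : ∀ s, ∑' x, {x | ¬ R x s}.indicator (a · s) x ≤ a (l s) s * w (l s)) :
    matchingDefect a R ≤ ∑' x, w x := by
  rw [← matchingDefect_flip]
  exact (ENNReal.tsum_le_tsum htail).trans (tsum_mul_comp_le_tsum hrow l w)

end Matching

/-! ### Lattice sums -/

section LatticeSums

variable {ι : Type*} [Fintype ι]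

theorem summable_norm_rpow_pi_int {r : ℝ} (hr : r < -Fintype.card ι) :
    Summable fun l : ι → ℤ => ‖l‖ ^ r := by
  classical
  let e := ((Pi.basisFun ℝ ι).restrictScalars ℤ).equivFun
  have norm_e_symm (l : ι → ℤ) : ‖e.symm l‖ = ‖l‖ := by
    have coe_e_symm : (e.symm l : ι → ℝ) = fun i => (l i : ℝ) := by
      ext i
      simp [e, Module.Basis.equivFun_symm_apply, Finset.sum_apply, Pi.basisFun_apply,
        Pi.single_apply]
    rw [Submodule.coe_norm, coe_e_symm]
    simp only [Pi.norm_def, nnnorm, Int.norm_cast_real]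
  have finrank_eq : Module.finrank ℤ (Submodule.span ℤ (Set.range (Pi.basisFun ℝ ι))) =
      Fintype.card ι := Module.finrank_eq_card_basis ((Pi.basisFun ℝ ι).restrictScalars ℤ)
  have h := ZLattice.summable_norm_rpow _ r (finrank_eq ▸ hr)
  simpa only [Function.comp_def, norm_e_symm] using h.comp_injective e.symm.injective

theorem isBigO_one_add_rpow_mul_exp_neg (p r : ℝ) {b : ℝ} (hb : 0 < b) :
    (fun t : ℝ => (1 + t) ^ p * Real.exp (-b * t)) =O[atTop] fun t => t ^ r := by
  have one_add_isTheta : (fun t : ℝ => 1 + t) =Θ[atTop] fun t => t := by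
    simp_rw [add_comm (1 : ℝ)]
    exact (IsEquivalent.refl.add_const_of_norm_tendsto_atTop tendsto_norm_atTop_atTop).isTheta
  have rpow_isTheta : (fun t : ℝ => (1 + t) ^ p) =Θ[atTop] fun t => t ^ p :=
    one_add_isTheta.rpow ((eventually_ge_atTop 0).mono fun t ht => add_nonneg zero_le_one ht)
      (eventually_ge_atTop 0)
  refine (rpow_isTheta.isBigO.mul (isLittleO_exp_neg_mul_rpow_atTop hb (r - p)).isBigO).congr'
    EventuallyEq.rfl ((eventually_gt_atTop 0).mono fun t ht => ?_)
  simp only [← Real.rpow_add ht, add_sub_cancel]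

theorem summable_one_add_norm_rpow_mul_exp_neg (p : ℝ) {b : ℝ} (hb : 0 < b) :
    Summable fun l : ι → ℤ => (1 + ‖l‖) ^ p * Real.exp (-b * ‖l‖) := by
  have norm_tendsto : Tendsto (fun l : ι → ℤ => ‖l‖) cofinite atTop :=
    cocompact_eq_cofinite (ι → ℤ) ▸ tendsto_norm_cocompact_atTop
  exact summable_of_isBigO (summable_norm_rpow_pi_int (sub_one_lt _))
    ((isBigO_one_add_rpow_mul_exp_neg p _ hb).comp_tendsto norm_tendsto)

end LatticeSums

/-- The lattice sum `∑ₓ e^{-c|x|}`, the total mass of the exponential profile bounding a localized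
function. -/
noncomputable def latticeExpSum (d : ℕ) (c : ℝ) : ℝ≥0∞ :=
  ∑' x : ZLattice d, ENNReal.ofReal (Real.exp (-c * ‖x‖))

/-- The prefactor `C (1 + |l|)^q` in the decay of a function localized at `l`. It takes values in
`ℝ≥0∞` so that the masses below can be summed unconditionally. -/
noncomputable def centerWeight {d : ℕ} (C q : ℝ) (l : ZLattice d) : ℝ≥0∞ :=
  ENNReal.ofReal (C * (1 + ‖l‖) ^ q)

section Weights

variable {d : ℕ} {b c : ℝ}

theorem latticeExpSum_ne_top (d : ℕ) (hc : 0 < c) : latticeExpSum d c ≠ ∞ := by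
  simpa [latticeExpSum] using
    (summable_one_add_norm_rpow_mul_exp_neg (ι := Fin d) 0 hc).tsum_ofReal_ne_top

theorem tsum_exp_neg_norm_sub (c : ℝ) (l : ZLattice d) :
    ∑' x, ENNReal.ofReal (Real.exp (-c * ‖x - l‖)) = latticeExpSum d c :=
  (Equiv.subRight l).tsum_eq fun x => ENNReal.ofReal (Real.exp (-c * ‖x‖))

theorem centerWeight_pow (C q : ℝ) (n : ℕ) (l : ZLattice d) :
    centerWeight C q l ^ n =
      ENNReal.ofReal C ^ n * ENNReal.ofReal ((1 + ‖l‖) ^ (q * n)) := by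
  rw [centerWeight, ENNReal.ofReal_mul' (by positivity), mul_pow,
    ← ENNReal.ofReal_pow (p := (1 + ‖l‖) ^ q) (by positivity),
    ← Real.rpow_mul_natCast (by positivity)]

theorem tsum_centerWeight_pow_mul_exp_neg_ne_top (C q : ℝ) (n : ℕ) (hb : 0 < b) :
    ∑' l : ZLattice d, centerWeight C q l ^ n * ENNReal.ofReal (Real.exp (-b * ‖l‖)) ≠ ∞ := by
  have hsum := summable_one_add_norm_rpow_mul_exp_neg (ι := Fin d) (q * n) hb
  simp_rw [centerWeight_pow, mul_assoc, ENNReal.tsum_mul_left,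
    ← ENNReal.ofReal_mul (Real.rpow_nonneg (add_nonneg zero_le_one (norm_nonneg _)) _)]
  exact ENNReal.mul_ne_top (by finiteness) hsum.tsum_ofReal_ne_top

theorem tendsto_tsum_centerWeight_pow_mul_exp_neg (d : ℕ) (C q : ℝ) (n : ℕ) (hb : 0 < b) :
    Tendsto (fun L : ℝ => ∑' l : ZLattice d,
      centerWeight C q l ^ n * ENNReal.ofReal (Real.exp (-b * (‖l‖ + L)))) atTop (𝓝 0) := by
  have factor (L : ℝ) (l : ZLattice d) :
      centerWeight C q l ^ n * ENNReal.ofReal (Real.exp (-b * (‖l‖ + L))) =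
        centerWeight C q l ^ n * ENNReal.ofReal (Real.exp (-b * ‖l‖)) *
          ENNReal.ofReal (Real.exp (-(b * L))) := by
    rw [mul_assoc, ← ENNReal.ofReal_mul (Real.exp_nonneg _), ← Real.exp_add]
    ring_nf
  simp_rw [factor, ENNReal.tsum_mul_right]
  have exp_tendsto : Tendsto (fun L => Real.exp (-(b * L))) atTop (𝓝 0) :=
    Real.tendsto_exp_neg_atTop_nhds_zero.comp (tendsto_id.const_mul_atTop hb)
  simpa using ENNReal.Tendsto.const_mul (ENNReal.tendsto_ofReal exp_tendsto)
    (Or.inr (tsum_centerWeight_pow_mul_exp_neg_ne_top (d := d) C q n hb))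

end Weights

/-! ### Square-summable functions and orthonormal bases -/

theorem tsum_enorm_sq_eq_enorm_sq {α : Type*} {E : α → Type*} [∀ x, NormedAddCommGroup (E x)]
    (φ : lp E 2) : ∑' x, ‖φ x‖ₑ ^ 2 = ‖φ‖ₑ ^ 2 := by
  have h : HasSum (fun x => ‖φ x‖ ^ 2) (‖φ‖ ^ 2) := by
    simpa using lp.hasSum_norm (p := 2) (by simp) φ
  simp_rw [← ofReal_norm, ← ENNReal.ofReal_pow (norm_nonneg _)]
  rw [← ENNReal.ofReal_tsum_of_nonneg (fun _ => by positivity) h.summable, h.tsum_eq]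

theorem enorm_hilbertBasis_apply {𝕜 E ι : Type*} [RCLike 𝕜] [NormedAddCommGroup E]
    [InnerProductSpace 𝕜 E] (ψ : HilbertBasis ι 𝕜 E) (s : ι) : ‖ψ s‖ₑ = 1 := by
  rw [← ofReal_norm, ψ.orthonormal.1 s, ENNReal.ofReal_one]

/-- Parseval's identity for the unit vector concentrated at `x`. -/
theorem tsum_enorm_sq_hilbertBasis_apply {α ι 𝕜 : Type*} [RCLike 𝕜]
    (ψ : HilbertBasis ι 𝕜 (lp (fun _ : α => 𝕜) 2)) (x : α) : ∑' s, ‖ψ s x‖ₑ ^ 2 = 1 := by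
  classical
  have parseval := tsum_enorm_sq_eq_enorm_sq (ψ.repr (lp.single 2 x (1 : 𝕜)))
  simpa [ψ.repr_apply_apply, lp.inner_single_right, ← ofReal_norm] using parseval

theorem localizationCenters_nonempty {d : ℕ} (φ : EllTwo d) : (localizationCenters φ).Nonempty := by
  by_cases hφ : ∃ x₀, φ x₀ ≠ 0
  · obtain ⟨x₀, hx₀⟩ := hφ
    have tendsto_zero : Tendsto (fun x => ‖φ x‖ ^ 2) (cocompact (ZLattice d)) (𝓝 0) := by
      rw [cocompact_eq_cofinite]
      simpa using ((lp.hasSum_norm (p := 2) (by simp) φ).summable.tendsto_cofinite_zero)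
    refine (continuous_of_discreteTopology (f := fun x => ‖φ x‖)).exists_forall_ge' x₀ ?_
    filter_upwards [tendsto_zero.eventually_le_const (show 0 < ‖φ x₀‖ ^ 2 by positivity)] with x hx
    exact le_of_sq_le_sq hx (norm_nonneg _)
  · push Not at hφ
    exact ⟨0, fun x => by simp [hφ]⟩

/-! ### Localized functions -/

section Localized

variable {d : ℕ} {C c q : ℝ} {φ : EllTwo d} {l : ZLattice d}

theorem SemiUniformlyLocalized.enorm_apply_le (hφ : SemiUniformlyLocalized C c q φ)
    (hl : l ∈ localizationCenters φ) (x : ZLattice d) :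
    ‖φ x‖ₑ ≤ centerWeight C q l * ENNReal.ofReal (Real.exp (-c * ‖x - l‖)) := by
  rw [centerWeight, ← ENNReal.ofReal_mul' (Real.exp_nonneg _), ← ofReal_norm]
  exact ENNReal.ofReal_le_ofReal (hφ l hl x)

theorem SemiUniformlyLocalized.enorm_sq_le (hφ : SemiUniformlyLocalized C c q φ)
    (hl : l ∈ localizationCenters φ) :
    ‖φ‖ₑ ^ 2 ≤ centerWeight C q l * latticeExpSum d c * ‖φ l‖ₑ := by
  rw [← tsum_enorm_sq_eq_enorm_sq, ← tsum_exp_neg_norm_sub c l, ← ENNReal.tsum_mul_left,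
    ← ENNReal.tsum_mul_right]
  refine ENNReal.tsum_le_tsum fun x => ?_
  rw [sq]
  gcongr
  · exact hφ.enorm_apply_le hl x
  · exact enorm_le_iff_norm_le.mpr (hl x)

theorem SemiUniformlyLocalized.tsum_enorm_sq_far_le (hc : 0 ≤ c)
    (hφ : SemiUniformlyLocalized C c q φ) (hl : l ∈ localizationCenters φ) (r : ℝ) :
    ∑' x, {x | ¬ ‖x - l‖ ≤ r}.indicator (‖φ ·‖ₑ ^ 2) x ≤
      centerWeight C q l ^ 2 * ENNReal.ofReal (Real.exp (-c * r)) * latticeExpSum d c := by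
  rw [← tsum_exp_neg_norm_sub c l, ← ENNReal.tsum_mul_left]
  refine ENNReal.tsum_le_tsum fun x => Set.indicator_apply_le' (fun hx => ?_) fun _ => zero_le
  have exp_le : Real.exp (-c * ‖x - l‖) ≤ Real.exp (-c * r) :=
    Real.exp_le_exp.mpr (mul_le_mul_of_nonpos_left (not_le.mp hx).le (neg_nonpos.mpr hc))
  calc ‖φ x‖ₑ ^ 2
    _ ≤ (centerWeight C q l * ENNReal.ofReal (Real.exp (-c * ‖x - l‖))) ^ 2 := by
      gcongr
      exact hφ.enorm_apply_le hl x
    _ = centerWeight C q l ^ 2 * ENNReal.ofReal (Real.exp (-c * ‖x - l‖)) *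
        ENNReal.ofReal (Real.exp (-c * ‖x - l‖)) := by ring
    _ ≤ centerWeight C q l ^ 2 * ENNReal.ofReal (Real.exp (-c * r)) *
        ENNReal.ofReal (Real.exp (-c * ‖x - l‖)) := by gcongr

theorem SemiUniformlyLocalized.tsum_enorm_sq_far_le_mul_center (hc : 0 ≤ c)
    (hφ : SemiUniformlyLocalized C c q φ) (hn : ‖φ‖ₑ = 1) (hl : l ∈ localizationCenters φ) (r : ℝ) :
    ∑' x, {x | ¬ ‖x - l‖ ≤ r}.indicator (‖φ ·‖ₑ ^ 2) x ≤
      ‖φ l‖ₑ ^ 2 * (latticeExpSum d c ^ 3 *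
        (centerWeight C q l ^ 4 * ENNReal.ofReal (Real.exp (-c * r)))) := by
  have one_le : 1 ≤ centerWeight C q l * latticeExpSum d c * ‖φ l‖ₑ := by
    simpa only [hn, one_pow] using hφ.enorm_sq_le hl
  -- Multiplying by the square of `one_le` makes the bound proportional to the mass at the center,
  -- and at each site these masses add up to at most one over an orthonormal family.
  calc ∑' x, {x | ¬ ‖x - l‖ ≤ r}.indicator (‖φ ·‖ₑ ^ 2) x
    _ ≤ centerWeight C q l ^ 2 * ENNReal.ofReal (Real.exp (-c * r)) * latticeExpSum d c :=
      hφ.tsum_enorm_sq_far_le hc hl r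
    _ ≤ centerWeight C q l ^ 2 * ENNReal.ofReal (Real.exp (-c * r)) * latticeExpSum d c *
        (centerWeight C q l * latticeExpSum d c * ‖φ l‖ₑ) ^ 2 :=
      le_mul_of_one_le_right' (one_le_pow₀ one_le)
    _ = _ := by ring

end Localized

theorem norm_sub_le_of_norm_sub_le_mul_add {E : Type*} [SeminormedAddCommGroup E] {x y : E}
    {δ L : ℝ} (hδ₀ : 0 ≤ δ) (hδ : δ ≤ 1 / 2) (h : ‖x - y‖ ≤ δ * (‖y‖ + L)) :
    ‖x - y‖ ≤ 2 * δ * (‖x‖ + L) := by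
  have norm_y_le : ‖y‖ ≤ ‖x‖ + ‖x - y‖ := norm_le_norm_add_norm_sub x y
  nlinarith [norm_nonneg (x - y)]

section LocalizedBasis

variable {d : ℕ} {C c q δ L : ℝ} {ι : Type*} {ψ : HilbertBasis ι ℂ (EllTwo d)}

theorem finite_setOf_mem_localizationCenters (hc : 0 < c)
    (hψ : ∀ s, SemiUniformlyLocalized C c q (ψ s)) (y : ZLattice d) :
    {s | y ∈ localizationCenters (ψ s)}.Finite := by
  set D := centerWeight C q y * latticeExpSum d c
  have D_ne_top : D ≠ ∞ := ENNReal.mul_ne_top ENNReal.ofReal_ne_top (latticeExpSum_ne_top d hc)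
  have one_le (s : ι) (hs : y ∈ localizationCenters (ψ s)) : 1 ≤ D ^ 2 * ‖ψ s y‖ₑ ^ 2 := by
    rw [← mul_pow]
    refine one_le_pow₀ ?_
    simpa only [enorm_hilbertBasis_apply, one_pow] using (hψ s).enorm_sq_le hs
  have tsum_ne_top : ∑' s, D ^ 2 * ‖ψ s y‖ₑ ^ 2 ≠ ∞ := by
    rw [ENNReal.tsum_mul_left, tsum_enorm_sq_hilbertBasis_apply ψ y]
    finiteness
  exact (ENNReal.finite_const_le_of_tsum_ne_top tsum_ne_top one_ne_zero).subset one_le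

theorem exists_equiv_norm_sub_center_le (hc : 0 < c) (hδ₀ : 0 ≤ δ) (hδ : δ ≤ 1 / 2)
    (hsum : ∑' y : ZLattice d, latticeExpSum d c ^ 3 *
      (centerWeight C q y ^ 4 * ENNReal.ofReal (Real.exp (-(c * δ) * (‖y‖ + L)))) < 1)
    (hψ : ∀ s, SemiUniformlyLocalized C c q (ψ s)) {l : ι → ZLattice d}
    (hl : ∀ s, l s ∈ localizationCenters (ψ s)) :
    ∃ f : ZLattice d ≃ ι, ∀ j, ‖j - l (f j)‖ ≤ 2 * δ * (‖j‖ + L) := by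
  have finite_ball (x : ZLattice d) (r : ℝ) : {y | ‖y - x‖ ≤ r}.Finite := by
    simpa only [Metric.closedBall, dist_eq_norm] using
      (isCompact_closedBall x r).finite_of_discrete
  have row_sum : ∀ x, ∑' s, ‖ψ s x‖ₑ ^ 2 = 1 := tsum_enorm_sq_hilbertBasis_apply ψ
  have column_sum (s : ι) : ∑' x, ‖ψ s x‖ₑ ^ 2 = 1 := by
    rw [tsum_enorm_sq_eq_enorm_sq, enorm_hilbertBasis_apply, one_pow]
  have defect_lt_one : matchingDefect (fun x s => ‖ψ s x‖ₑ ^ 2)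
      (fun x s => ‖x - l s‖ ≤ δ * (‖l s‖ + L)) < 1 := by
    refine (matchingDefect_le_tsum (fun x => (row_sum x).le) l _ fun s => ?_).trans_lt hsum
    simpa only [neg_mul, mul_assoc] using (hψ s).tsum_enorm_sq_far_le_mul_center hc.le
      (enorm_hilbertBasis_apply ψ s) (hl s) (δ * (‖l s‖ + L))
  have finite_row (x : ZLattice d) : {s | ‖x - l s‖ ≤ δ * (‖l s‖ + L)}.Finite := by
    have finite_fiber (y : ZLattice d) : (l ⁻¹' {y}).Finite :=
      (finite_setOf_mem_localizationCenters hc hψ y).subset (by rintro s rfl; exact hl s)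
    refine ((finite_ball x (2 * δ * (‖x‖ + L))).preimage' fun y _ => finite_fiber y).subset
      fun s hs => ?_
    simpa only [Set.mem_preimage, Set.mem_ofPred_eq, norm_sub_rev] using
      norm_sub_le_of_norm_sub_le_mul_add hδ₀ hδ hs
  obtain ⟨f, hf⟩ := exists_equiv_of_matchingDefect_lt_one row_sum column_sum defect_lt_one
    finite_row fun s => finite_ball (l s) _
  exact ⟨f, fun j => norm_sub_le_of_norm_sub_le_mul_add hδ₀ hδ (hf j)⟩

end LocalizedBasis

theorem exists_scale_tsum_lt_one (d : ℕ) (C q L₀ : ℝ) {c δ : ℝ} (hc : 0 < c) (hδ : 0 < δ) :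
    ∃ L : ℝ, L₀ ≤ L ∧ ∑' y : ZLattice d, latticeExpSum d c ^ 3 *
      (centerWeight C q y ^ 4 * ENNReal.ofReal (Real.exp (-(c * δ) * (‖y‖ + L)))) < 1 := by
  have tsum_tendsto := ENNReal.Tendsto.const_mul
    (tendsto_tsum_centerWeight_pow_mul_exp_neg d C q 4 (mul_pos hc hδ))
    (Or.inr (ENNReal.pow_ne_top (n := 3) (latticeExpSum_ne_top d hc)))
  simp_rw [mul_zero, ← ENNReal.tsum_mul_left] at tsum_tendsto
  exact ((eventually_ge_atTop L₀).and (tsum_tendsto.eventually_lt_const one_pos)).exists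

theorem theoremB6_general (d : ℕ) (C c q ε : ℝ) (hc : 0 < c) (hε : 0 < ε) :
    ∃ L : ℝ, 500 ≤ L ∧
      ∀ (ι : Type*) (ψ : HilbertBasis ι ℂ (EllTwo d)),
        (∀ s, SemiUniformlyLocalized C c q (ψ s)) →
        ∃ f : ZLattice d ≃ ι,
          ∀ j : ZLattice d, L ≤ ‖j‖ →
            ∃ l ∈ localizationCenters (ψ (f j)), ‖j - l‖ ≤ ε * ‖j‖ := by
  obtain ⟨δ, hδ₀, hδ, hδε⟩ : ∃ δ : ℝ, 0 < δ ∧ δ ≤ 1 / 2 ∧ δ ≤ ε / 4 :=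
    ⟨min (1 / 2) (ε / 4), by positivity, min_le_left _ _, min_le_right _ _⟩
  obtain ⟨L, hL, tsum_lt_one⟩ := exists_scale_tsum_lt_one d C q 500 hc hδ₀
  refine ⟨L, hL, fun ι ψ hψ => ?_⟩
  choose l hl using fun s => localizationCenters_nonempty (ψ s)
  obtain ⟨f, hf⟩ := exists_equiv_norm_sub_center_le hc hδ₀.le hδ tsum_lt_one hψ hl
  refine ⟨f, fun j hj => ⟨l (f j), hl _, ?_⟩⟩
  calc ‖j - l (f j)‖ ≤ 2 * δ * (‖j‖ + L) := hf j
    _ ≤ 2 * (ε / 4) * (‖j‖ + ‖j‖) := by gcongr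
    _ = ε * ‖j‖ := by ring

theorem theoremB6 (d : ℕ) (C c q ε : ℝ) (hC : 0 < C) (hc : 0 < c) (hq : 0 < q) (hε : 0 < ε) :
    ∃ L : ℝ, 500 ≤ L ∧
      ∀ (H : EllTwo d →ₗ.[ℂ] EllTwo d) (ψ : HilbertBasis (ZLattice d) ℂ (EllTwo d)),
        (∀ s, IsEigenfunction H (ψ s)) →
        (∀ s, SemiUniformlyLocalized C c q (ψ s)) →
        ∃ f : ZLattice d ≃ ZLattice d,
          ∀ j : ZLattice d, L ≤ ‖j‖ →
            ∃ l ∈ localizationCenters (ψ (f j)), ‖j - l‖ ≤ ε * ‖j‖ := by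
  obtain ⟨L, hL, hf⟩ := theoremB6_general d C c q ε hc hε
  exact ⟨L, hL, fun _ ψ _ hψ => hf (ZLattice d) ψ hψ⟩
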